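/- A sequence (or double sequence) of rational numbers is computable if it has the form $(f-g)/(d+1)$ with total computable functions $f,g,d$ with values in $\mathbb{N}$. A real number $\alpha$ is lower semicomputable if it is the limit of a computable strictly increasing sequence $(a_n)$ of rational numbers; such a sequence is called an approximation of $\alpha$ from below. For lower semicomputable reals $\alpha,\beta$ with approximations from below $(a_n)$, $(b_n)$, write $\alpha\preceq_1\beta$ if there is a total computable function $h\colon\mathbb{N}\to\mathbb{N}$ such that $\alpha-a_{h(i)}\le\beta-b_i$ for every $i$ (this does not depend on the choice of the approximations), and write $\alpha\preceq\beta$ (Solovay reducibility) if $\alpha\preceq_1 c\beta$ for some positive integer $c$. A lower semicomputable real $\beta$ is (Solovay) complete if $\alpha\preceq\beta$ for every lower semicomputable real $\alpha$. A real number $\alpha$ is Martin-Löf random if there is no computable double sequence $(I_{n,k})_{n,k\in\mathbb{N}}$ of (possibly empty) open intervals with rational endpoints such that, for every $n$, $\sum_k |I_{n,k}|\le 2^{-n}$ and $\alpha\in\bigcup_k I_{n,k}$. Theorem. A lower semicomputable real $\beta$ is complete if and only if it is Martin-Löf random. -/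

import Mathlib

open scoped ENNReal

namespace SemicomputableReals

/-- A rational-valued function on an effectively coded set (for instance a sequence, or a double
sequence) is computable if it can be written as `q x = (f x - g x) / (d x + 1)` with total computable
functions `f`, `g`, `d` with values in the natural numbers. -/
def ComputableRat {X : Type*} [Primcodable X] (q : X → ℚ) : Prop :=
  ∃ f g d : X → ℕ, Computable f ∧ Computable g ∧ Computable d ∧
    ∀ x, q x = ((f x : ℚ) - (g x : ℚ)) / ((d x : ℚ) + 1)

/-- `a` is an approximation of `α` from below: a computable strictly increasing sequence of
rational numbers that converges to `α`. -/
structure ApproxBelow (a : ℕ → ℚ) (α : ℝ) : Prop where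
  computable : ComputableRat a
  strictMono : StrictMono a
  tendsto : Filter.Tendsto (fun n => (a n : ℝ)) Filter.atTop (nhds α)

/-- A real is lower semicomputable if it has an approximation from below. -/
def LowerSemicomputable (α : ℝ) : Prop :=
  ∃ a : ℕ → ℚ, ApproxBelow a α

/-- `a → α` converges better (not worse) than `b → β`. -/
def ConvergesBetter (a : ℕ → ℚ) (α : ℝ) (b : ℕ → ℚ) (β : ℝ) : Prop :=
  ∃ h : ℕ → ℕ, Computable h ∧ ∀ i, α - (a (h i) : ℝ) ≤ β - (b i : ℝ)

/-- The relation `α ⪯₁ β` between lower semicomputable reals: some approximation of `α` from below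
converges better than some approximation of `β` from below. (Any two approximations of the same
real converge equally well, so the choice of the approximations is irrelevant.) -/
def SolovayLeOne (α β : ℝ) : Prop :=
  ∃ a b : ℕ → ℚ, ApproxBelow a α ∧ ApproxBelow b β ∧ ConvergesBetter a α b β

/-- Solovay reducibility `α ⪯ β`: `α ⪯₁ c β` for some positive integer `c`. -/
def SolovayLe (α β : ℝ) : Prop :=
  ∃ c : ℕ, 0 < c ∧ SolovayLeOne α ((c : ℝ) * β)

/-- A (Solovay) complete real: a biggest lower semicomputable real for Solovay reducibility. -/
def SolovayComplete (β : ℝ) : Prop :=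
  LowerSemicomputable β ∧ ∀ α : ℝ, LowerSemicomputable α → SolovayLe α β

/-- A Martin-Löf test on the real line: a computable double sequence of open intervals with rational
endpoints (empty if the left endpoint is not below the right one) such that the intervals of the
`n`-th row have total length at most `2⁻ⁿ`. -/
structure MartinLofTest where
  left : ℕ × ℕ → ℚ
  right : ℕ × ℕ → ℚ
  left_computable : ComputableRat left
  right_computable : ComputableRat right
  total_length_le : ∀ n : ℕ,
    ∑' k : ℕ, MeasureTheory.volume (Set.Ioo (left (n, k) : ℝ) (right (n, k) : ℝ)) ≤ (2⁻¹ : ℝ≥0∞) ^ n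

/-- The effectively open set covered by the `n`-th row of a test. -/
def MartinLofTest.cover (T : MartinLofTest) (n : ℕ) : Set ℝ :=
  ⋃ k : ℕ, Set.Ioo (T.left (n, k) : ℝ) (T.right (n, k) : ℝ)

/-- A real is Martin-Löf random if no Martin-Löf test covers it at all levels, that is, if it lies
in no effectively null set. -/
def MartinLofRandom (α : ℝ) : Prop :=
  ∀ T : MartinLofTest, α ∉ ⋂ n : ℕ, T.cover n

end SemicomputableReals

/-! Random implies complete. Let a → α and b → β from below, and fix ε > 0. Whenever b has risen by
ε times the previous increment of a, an interval starting at the current b s is enumerated, of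
length 2ε times the new increment of a. The lengths telescope to at most 2ε(α - a 0), so ε =
2^-(n+m), for a suitable m, gives a Martin-Löf test. If β escapes level n, b passes every threshold,
so it keeps gaining ε times the increments of a. Hence ε(α - a(h i)) ≤ β - b i for a computable h
(`mul_sub_le_of_not_covered`), which is α ⪯ β with factor 1/ε.

Complete implies random. If a test covers β, some α is not reducible to β. A number e codes a factor
c ≤ e and a candidate reduction g. For each interval I of level 2e, once the first b i beyond its
left end is known to lie in I and g(i) has been computed, e·|I| is added to α after stage g(i). If β
∈ I, this exceeds c(β - b i) and refutes the reduction. Each interval is charged at most once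
(`Fires.snd_eq`), so the total is at most ∑ e·2^(-2e) ≤ ∑ 2^(-e), which is finite. -/

namespace SemicomputableReals

/-! ### Closure properties of computable predicates and computable rational functions. -/

section Calculus

variable {X Y : Type*} [Primcodable X] [Primcodable Y]

theorem computable_nat_add {f g : X → ℕ} (hf : Computable f) (hg : Computable g) :
    Computable fun x => f x + g x :=
  Primrec.nat_add.to_comp.comp hf hg

theorem computable_nat_mul {f g : X → ℕ} (hf : Computable f) (hg : Computable g) :
    Computable fun x => f x * g x :=
  Primrec.nat_mul.to_comp.comp hf hg

theorem computable_two_pow : Computable fun n : ℕ => 2 ^ n :=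
  ((Primrec₂.unpaired'.1 Nat.Primrec.pow).comp (Primrec.const 2) Primrec.id).to_comp

theorem computablePred_comp {p : Y → Prop} {f : X → Y} (hp : ComputablePred p)
    (hf : Computable f) : ComputablePred fun x => p (f x) := by
  classical
  exact (hp.decide.comp hf).computablePred

theorem computablePred_and {p q : X → Prop} (hp : ComputablePred p) (hq : ComputablePred q) :
    ComputablePred fun x => p x ∧ q x := by
  classical
  refine Computable.computablePred ((Primrec.and.to_comp.comp hp.decide hq.decide).of_eq ?_)
  intro x
  simp

theorem computablePred_or {p q : X → Prop} (hp : ComputablePred p) (hq : ComputablePred q) :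
    ComputablePred fun x => p x ∨ q x := by
  classical
  refine Computable.computablePred ((Primrec.or.to_comp.comp hp.decide hq.decide).of_eq ?_)
  intro x
  simp

theorem computablePred_eq [DecidableEq Y] {f g : X → Y} (hf : Computable f)
    (hg : Computable g) : ComputablePred fun x => f x = g x :=
  computablePred_comp (p := fun y : Y × Y => y.1 = y.2) Primrec.eq.computablePred (hf.pair hg)

theorem computablePred_nat_le {f g : X → ℕ} (hf : Computable f)
    (hg : Computable g) : ComputablePred fun x => f x ≤ g x :=
  computablePred_comp (p := fun y : ℕ × ℕ => y.1 ≤ y.2) Primrec.nat_le.computablePred (hf.pair hg)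

theorem computable_ite {p : X → Prop} [DecidablePred p] {f g : X → Y} (hp : ComputablePred p)
    (hf : Computable f) (hg : Computable g) : Computable fun x => if p x then f x else g x := by
  simpa [Bool.cond_decide] using hp.decide.cond hf hg

namespace ComputableRat

theorem comp {q : Y → ℚ} {f : X → Y} (hq : ComputableRat q) (hf : Computable f) :
    ComputableRat fun x => q (f x) := by
  obtain ⟨u, v, d, hu, hv, hd, h⟩ := hq
  exact ⟨_, _, _, hu.comp hf, hv.comp hf, hd.comp hf, fun x => h (f x)⟩

theorem of_eq {q r : X → ℚ} (hq : ComputableRat q) (h : ∀ x, q x = r x) : ComputableRat r :=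
  funext h ▸ hq

theorem natCast {f : X → ℕ} (hf : Computable f) : ComputableRat fun x => (f x : ℚ) :=
  ⟨f, fun _ => 0, fun _ => 0, hf, Computable.const 0, Computable.const 0, fun x => by simp⟩

theorem const (q : ℚ) : ComputableRat fun _ : X => q := by
  refine ⟨fun _ => q.num.toNat, fun _ => (-q.num).toNat, fun _ => q.den.pred, Computable.const _,
    Computable.const _, Computable.const _, fun _ => ?_⟩
  have h1 : ((q.den.pred : ℕ) : ℚ) + 1 = q.den := by
    have := Nat.succ_pred_eq_of_pos q.den_pos
    exact_mod_cast this
  have h2 : ((q.num.toNat : ℕ) : ℚ) - ((-q.num).toNat : ℕ) = q.num := by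
    have := Int.toNat_sub_toNat_neg q.num
    exact_mod_cast this
  rw [h1, h2, Rat.num_div_den]

theorem half_pow {f : X → ℕ} (hf : Computable f) :
    ComputableRat fun x => (1 / 2 : ℚ) ^ f x := by
  refine ⟨fun _ => 1, fun _ => 0, fun x => Nat.pred (2 ^ f x), Computable.const 1,
    Computable.const 0, Computable.pred.comp (computable_two_pow.comp hf), fun x => ?_⟩
  have h : ((Nat.pred (2 ^ f x) : ℕ) : ℚ) + 1 = 2 ^ f x := by
    have : Nat.pred (2 ^ f x) + 1 = 2 ^ f x := Nat.succ_pred_eq_of_pos (by positivity)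
    exact_mod_cast this
  rw [h]
  simp

theorem add {q r : X → ℚ} (hq : ComputableRat q) (hr : ComputableRat r) :
    ComputableRat fun x => q x + r x := by
  obtain ⟨f, g, d, hf, hg, hd, h⟩ := hq
  obtain ⟨f', g', d', hf', hg', hd', h'⟩ := hr
  have hs := Computable.succ.comp hd
  have hs' := Computable.succ.comp hd'
  refine ⟨fun x => f x * (d' x).succ + f' x * (d x).succ,
    fun x => g x * (d' x).succ + g' x * (d x).succ,
    -- Denominators are stored minus one: this is (d + 1)(d' + 1) - 1.
    fun x => d x * d' x + d x + d' x,
    computable_nat_add (computable_nat_mul hf hs') (computable_nat_mul hf' hs),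
    computable_nat_add (computable_nat_mul hg hs') (computable_nat_mul hg' hs),
    computable_nat_add (computable_nat_add (computable_nat_mul hd hd') hd) hd', fun x => ?_⟩
  have h1 : (d x : ℚ) + 1 ≠ 0 := by positivity
  have h2 : (d' x : ℚ) + 1 ≠ 0 := by positivity
  have h3 : ((d x * d' x + d x + d' x : ℕ) : ℚ) + 1 = (d x + 1) * (d' x + 1) := by
    push_cast; ring
  beta_reduce
  rw [h, h', h3]
  push_cast
  field_simp
  ring

theorem neg {q : X → ℚ} (hq : ComputableRat q) : ComputableRat fun x => -q x := by
  obtain ⟨f, g, d, hf, hg, hd, h⟩ := hq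
  exact ⟨g, f, d, hg, hf, hd, fun x => by beta_reduce; rw [h]; ring⟩

theorem sub {q r : X → ℚ} (hq : ComputableRat q) (hr : ComputableRat r) :
    ComputableRat fun x => q x - r x :=
  (hq.add hr.neg).of_eq fun x => by ring

theorem mul {q r : X → ℚ} (hq : ComputableRat q) (hr : ComputableRat r) :
    ComputableRat fun x => q x * r x := by
  obtain ⟨f, g, d, hf, hg, hd, h⟩ := hq
  obtain ⟨f', g', d', hf', hg', hd', h'⟩ := hr
  refine ⟨fun x => f x * f' x + g x * g' x, fun x => f x * g' x + g x * f' x,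
    fun x => d x * d' x + d x + d' x,
    computable_nat_add (computable_nat_mul hf hf') (computable_nat_mul hg hg'),
    computable_nat_add (computable_nat_mul hf hg') (computable_nat_mul hg hf'),
    computable_nat_add (computable_nat_add (computable_nat_mul hd hd') hd) hd', fun x => ?_⟩
  have h1 : (d x : ℚ) + 1 ≠ 0 := by positivity
  have h2 : (d' x : ℚ) + 1 ≠ 0 := by positivity
  have h3 : ((d x * d' x + d x + d' x : ℕ) : ℚ) + 1 = (d x + 1) * (d' x + 1) := by
    push_cast; ring
  beta_reduce
  rw [h, h', h3]
  push_cast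
  field_simp
  ring

theorem computablePred_le {q r : X → ℚ} (hq : ComputableRat q) (hr : ComputableRat r) :
    ComputablePred fun x => q x ≤ r x := by
  obtain ⟨f, g, d, hf, hg, hd, h⟩ := hq
  obtain ⟨f', g', d', hf', hg', hd', h'⟩ := hr
  have hs := Computable.succ.comp hd
  have hs' := Computable.succ.comp hd'
  refine (computablePred_nat_le
    (computable_nat_add (computable_nat_mul hf hs') (computable_nat_mul hg' hs))
    (computable_nat_add (computable_nat_mul hf' hs) (computable_nat_mul hg hs'))).of_eq fun x => ?_
  have h1 : 0 < (d x : ℚ) + 1 := by positivity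
  have h2 : 0 < (d' x : ℚ) + 1 := by positivity
  rw [h, h', div_le_div_iff₀ h1 h2, ← Nat.cast_le (α := ℚ)]
  push_cast
  constructor <;> intro h <;> linarith

theorem computablePred_lt {q r : X → ℚ} (hq : ComputableRat q) (hr : ComputableRat r) :
    ComputablePred fun x => q x < r x :=
  (hr.computablePred_le hq).not.of_eq fun _ => not_le

theorem ite {p : X → Prop} [DecidablePred p] {q r : X → ℚ} (hp : ComputablePred p)
    (hq : ComputableRat q) (hr : ComputableRat r) :
    ComputableRat fun x => if p x then q x else r x := by
  obtain ⟨f, g, d, hf, hg, hd, h⟩ := hq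
  obtain ⟨f', g', d', hf', hg', hd', h'⟩ := hr
  refine ⟨_, _, _, computable_ite hp hf hf', computable_ite hp hg hg', computable_ite hp hd hd',
    fun x => ?_⟩
  beta_reduce
  split_ifs
  exacts [h x, h' x]

theorem sum_range {q : ℕ → ℚ} (hq : ComputableRat q) :
    ComputableRat fun n => ∑ t ∈ Finset.range n, q t := by
  obtain ⟨f, g, d, hf, hg, hd, h⟩ := hq
  let step : ℕ → ℕ × (ℕ × ℕ × ℕ) → ℕ × ℕ × ℕ := fun _ y =>
    (f y.1 * (y.2.2.2).succ + y.2.1 * (d y.1).succ,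
      g y.1 * (y.2.2.2).succ + y.2.2.1 * (d y.1).succ,
      d y.1 * y.2.2.2 + d y.1 + y.2.2.2)
  have hstep : Computable₂ step := by
    have ht : Computable fun x : ℕ × (ℕ × (ℕ × ℕ × ℕ)) => x.2.1 :=
      Computable.fst.comp Computable.snd
    have hF : Computable fun x : ℕ × (ℕ × (ℕ × ℕ × ℕ)) => x.2.2.1 :=
      Computable.fst.comp (Computable.snd.comp Computable.snd)
    have hG : Computable fun x : ℕ × (ℕ × (ℕ × ℕ × ℕ)) => x.2.2.2.1 :=
      Computable.fst.comp (Computable.snd.comp (Computable.snd.comp Computable.snd))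
    have hD : Computable fun x : ℕ × (ℕ × (ℕ × ℕ × ℕ)) => x.2.2.2.2 :=
      Computable.snd.comp (Computable.snd.comp (Computable.snd.comp Computable.snd))
    have hD' := Computable.succ.comp hD
    have hd' := Computable.succ.comp (hd.comp ht)
    exact (computable_nat_add (computable_nat_mul (hf.comp ht) hD')
      (computable_nat_mul hF hd')).pair
      ((computable_nat_add (computable_nat_mul (hg.comp ht) hD')
        (computable_nat_mul hG hd')).pair
        (computable_nat_add (computable_nat_add (computable_nat_mul (hd.comp ht) hD)
          (hd.comp ht)) hD))
  have hrec : Computable fun n : ℕ =>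
      Nat.rec (motive := fun _ => ℕ × ℕ × ℕ) (0, 0, 0) (fun y IH => step n (y, IH)) n :=
    Computable.nat_rec Computable.id (Computable.const (0, 0, 0)) hstep
  -- `step` ignores its first argument, so replacing n by 0 there changes nothing definitionally and
  -- gives the usual recursion.
  let S : ℕ → ℕ × ℕ × ℕ := fun n =>
    Nat.rec (motive := fun _ => ℕ × ℕ × ℕ) (0, 0, 0) (fun y IH => step 0 (y, IH)) n
  have hS : Computable S := hrec
  refine ⟨fun n => (S n).1, fun n => (S n).2.1, fun n => (S n).2.2, Computable.fst.comp hS,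
    Computable.fst.comp (Computable.snd.comp hS), Computable.snd.comp (Computable.snd.comp hS),
    fun n => ?_⟩
  induction n with
  | zero => simp [S]
  | succ n ih =>
    have h1 : (d n : ℚ) + 1 ≠ 0 := by positivity
    have h2 : ((S n).2.2 : ℚ) + 1 ≠ 0 := by positivity
    have hSn : S (n + 1) = step 0 (n, S n) := rfl
    have h3 : ((d n * (S n).2.2 + d n + (S n).2.2 : ℕ) : ℚ) + 1
        = (d n + 1) * ((S n).2.2 + 1) := by push_cast; ring
    beta_reduce at ih ⊢
    rw [Finset.sum_range_succ, ih, h, hSn]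
    simp only [step]
    rw [h3]
    push_cast
    field_simp
    ring

end ComputableRat

end Calculus

/-! ### Approximations from below. -/

namespace ApproxBelow

variable {a : ℕ → ℚ} {α : ℝ}

theorem lt_limit (ha : ApproxBelow a α) (n : ℕ) : (a n : ℝ) < α := by
  have hm : StrictMono fun n => (a n : ℝ) := fun i j h =>
    Rat.cast_lt.2 (ha.strictMono h)
  exact (hm (Nat.lt_succ_self n)).trans_le (hm.monotone.ge_of_tendsto ha.tendsto _)

theorem exists_lt (ha : ApproxBelow a α) {x : ℝ} (hx : x < α) : ∃ n, x < a n :=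
  (ha.tendsto.eventually_const_lt hx).exists

theorem natCast_mul (ha : ApproxBelow a α) {c : ℕ} (hc : 0 < c) :
    ApproxBelow (fun n => (c : ℚ) * a n) (c * α) where
  computable := (ComputableRat.natCast (Computable.const c)).mul ha.computable
  strictMono := fun i j h => by
    have hc' : (0 : ℚ) < c := by exact_mod_cast hc
    exact mul_lt_mul_of_pos_left (ha.strictMono h) hc'
  tendsto := by
    simpa using ha.tendsto.const_mul (c : ℝ)

end ApproxBelow

/-! ### Random implies complete: intervals placed ahead of b. -/

section RandomToComplete

/-- The value that `b` has to reach before the pair of stages `x` is replaced. -/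
def threshold (a b : ℕ → ℚ) (ε : ℚ) (x : ℕ × ℕ) : ℚ :=
  b x.1 + ε * (a x.1 - a x.2)

/-- The last two stages, before stage `s`, at which `b` reached its current threshold. -/
def lastStages (a b : ℕ → ℚ) (ε : ℚ) : ℕ → ℕ × ℕ
  | 0 => (0, 0)
  | s + 1 =>
    if threshold a b ε (lastStages a b ε s) ≤ b s then (s, (lastStages a b ε s).1)
    else lastStages a b ε s

variable {a b : ℕ → ℚ} {ε : ℚ} {α β : ℝ}

theorem computablePred_threshold_le (ha : ComputableRat a) (hb : ComputableRat b)
    {X : Type*} [Primcodable X] {e : X → ℚ} (he : ComputableRat e) {x : X → ℕ × ℕ}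
    (hx : Computable x) {s : X → ℕ} (hs : Computable s) :
    ComputablePred fun y => threshold a b (e y) (x y) ≤ b (s y) :=
  ComputableRat.computablePred_le
    ((hb.comp (Computable.fst.comp hx)).add
      (he.mul ((ha.comp (Computable.fst.comp hx)).sub (ha.comp (Computable.snd.comp hx)))))
    (hb.comp hs)

theorem computable_lastStages (ha : ComputableRat a) (hb : ComputableRat b)
    {X : Type*} [Primcodable X] {e : X → ℚ} (he : ComputableRat e) {s : X → ℕ}
    (hs : Computable s) : Computable fun x => lastStages a b (e x) (s x) := by
  have hstage : Computable fun y : X × (ℕ × (ℕ × ℕ)) => y.2.1 :=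
    Computable.fst.comp Computable.snd
  have hprev : Computable fun y : X × (ℕ × (ℕ × ℕ)) => y.2.2 :=
    Computable.snd.comp Computable.snd
  have hstep : Computable₂ fun (x : X) (y : ℕ × (ℕ × ℕ)) =>
      if threshold a b (e x) y.2 ≤ b y.1 then (y.1, y.2.1) else y.2 :=
    computable_ite (computablePred_threshold_le ha hb (he.comp Computable.fst) hprev hstage)
      (hstage.pair (Computable.fst.comp hprev)) hprev
  refine (Computable.nat_rec hs (Computable.const (0, 0)) hstep).of_eq fun x => ?_
  induction s x with
  | zero => rfl
  | succ n ih => simp only [lastStages, ih]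

theorem lastStages_fst_le_succ (a b : ℕ → ℚ) (ε : ℚ) (s : ℕ) :
    (lastStages a b ε s).1 ≤ s ∧ (lastStages a b ε s).1 ≤ (lastStages a b ε (s + 1)).1 := by
  have h : ∀ s, (lastStages a b ε s).1 ≤ s := by
    intro s
    induction s with
    | zero => simp [lastStages]
    | succ s ih =>
      rw [lastStages]
      split_ifs
      · exact Nat.le_succ s
      · exact ih.trans (Nat.le_succ s)
  refine ⟨h s, ?_⟩
  rw [lastStages]
  split_ifs
  · exact h s
  · exact le_rfl

theorem lastStages_succ_of_le {s : ℕ} (h : threshold a b ε (lastStages a b ε s) ≤ b s) :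
    lastStages a b ε (s + 1) = (s, (lastStages a b ε s).1) := by
  rw [lastStages, if_pos h]

theorem lastStages_succ_of_not_le {s : ℕ} (h : ¬ threshold a b ε (lastStages a b ε s) ≤ b s) :
    lastStages a b ε (s + 1) = lastStages a b ε s := by
  rw [lastStages, if_neg h]

/-- The right endpoint of the interval, with left endpoint `b s`, enumerated at stage `s`. -/
def rightEnd (a b : ℕ → ℚ) (ε : ℚ) (s : ℕ) : ℚ :=
  b s + 2 * ε * (a (lastStages a b ε (s + 1)).1 - a (lastStages a b ε s).1)

/-- The lengths telescope along the first components of `lastStages`; stages without an update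
contribute empty intervals. -/
theorem tsum_volume_rightEnd_le (ha : ApproxBelow a α) (hε : 0 ≤ ε) :
    ∑' s, MeasureTheory.volume (Set.Ioo (b s : ℝ) (rightEnd a b ε s : ℝ))
      ≤ ENNReal.ofReal (2 * ε * (α - a 0)) := by
  refine ENNReal.summable.tsum_le_of_sum_range_le fun N => ?_
  have hnn : ∀ s, (0 : ℝ) ≤
      2 * ε * (a (lastStages a b ε (s + 1)).1 - a (lastStages a b ε s).1) := fun s => by
    have h : (a (lastStages a b ε s).1 : ℝ) ≤ a (lastStages a b ε (s + 1)).1 :=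
      Rat.cast_le.2 (ha.strictMono.monotone (lastStages_fst_le_succ a b ε s).2)
    have : (0 : ℝ) ≤ ε := by exact_mod_cast hε
    exact mul_nonneg (by positivity) (sub_nonneg.2 h)
  have hvol : ∀ s, MeasureTheory.volume (Set.Ioo (b s : ℝ) (rightEnd a b ε s : ℝ))
      = ENNReal.ofReal
        (2 * ε * (a (lastStages a b ε (s + 1)).1 - a (lastStages a b ε s).1)) := fun s => by
    rw [Real.volume_Ioo, rightEnd]
    push_cast
    congr 1
    ring
  simp only [hvol]
  rw [← ENNReal.ofReal_sum_of_nonneg fun s _ => hnn s, ← Finset.mul_sum,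
    Finset.sum_range_sub (fun s => (a (lastStages a b ε s).1 : ℝ))]
  refine ENNReal.ofReal_le_ofReal (mul_le_mul_of_nonneg_left ?_ ?_)
  · have := (ha.lt_limit (lastStages a b ε N).1).le
    simpa [lastStages] using this
  · have : (0 : ℝ) ≤ ε := by exact_mod_cast hε
    positivity

section NotCovered

variable (ha : ApproxBelow a α) (hb : ApproxBelow b β) (hε : 0 < ε)
  (hβ : ∀ s, β ∉ Set.Ioo (b s : ℝ) (rightEnd a b ε s : ℝ))

include ha hb hε hβ

/-- Escaping the interval only gives `rightEnd` ≤ β. The threshold is its midpoint, and b s < β, so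
the factor 2 makes the inequality strict. -/
theorem threshold_lt_of_not_covered (s : ℕ) :
    (threshold a b ε (lastStages a b ε s) : ℝ) < β := by
  induction s with
  | zero => simpa [threshold, lastStages] using hb.lt_limit 0
  | succ s ih =>
    by_cases h : threshold a b ε (lastStages a b ε s) ≤ b s
    · have h1 : (rightEnd a b ε s : ℝ) ≤ β := by
        by_contra hlt
        exact hβ s ⟨hb.lt_limit s, not_le.1 hlt⟩
      rw [rightEnd, lastStages_succ_of_le h] at h1
      rw [lastStages_succ_of_le h, threshold]
      have h2 : (a (lastStages a b ε s).1 : ℝ) ≤ a s :=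
        Rat.cast_le.2 (ha.strictMono.monotone (lastStages_fst_le_succ a b ε s).1)
      have h3 : (0 : ℝ) < ε := by exact_mod_cast hε
      have h4 := hb.lt_limit s
      push_cast at h1 ⊢
      have h5 := mul_nonneg h3.le (sub_nonneg.2 h2)
      nlinarith
    · rwa [lastStages_succ_of_not_le h]

/-- Without further updates the threshold would stay constant and below β, so b would eventually
pass it. -/
theorem exists_threshold_le_of_not_covered (i : ℕ) :
    ∃ s, i ≤ s ∧ threshold a b ε (lastStages a b ε s) ≤ b s := by
  by_contra! hcon
  have hconst : ∀ k, lastStages a b ε (i + k) = lastStages a b ε i := by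
    intro k
    induction k with
    | zero => rfl
    | succ k ih =>
      rw [← add_assoc, lastStages_succ_of_not_le (not_le.2 (hcon _ (Nat.le_add_right i k))), ih]
  obtain ⟨n, hn⟩ := hb.exists_lt (threshold_lt_of_not_covered ha hb hε hβ i)
  have h1 := hcon (i + n) (Nat.le_add_right i n)
  rw [hconst] at h1
  have h2 : b n ≤ b (i + n) := hb.strictMono.monotone (Nat.le_add_left n i)
  exact lt_asymm (h1.trans_le' h2) (by exact_mod_cast hn)

/-- From an update at s on, every threshold stays above b s plus ε times the total increase of a
since the preceding update. Thresholds lie below β and updates never stop, so the bound passes to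
the limit. -/
theorem mul_sub_le_of_not_covered {s : ℕ}
    (hs : threshold a b ε (lastStages a b ε s) ≤ b s) :
    ε * (α - a (lastStages a b ε s).1) ≤ β - b s := by
  -- At each later update b has reached the old threshold, and the new one adds ε times the latest
  -- increment of a.
  have hinc : ∀ k, b s + ε * (a (lastStages a b ε (s + 1 + k)).1 - a (lastStages a b ε s).1)
      ≤ threshold a b ε (lastStages a b ε (s + 1 + k)) := by
    intro k
    induction k with
    | zero => rw [add_zero, lastStages_succ_of_le hs, threshold]
    | succ k ih =>
      rw [← add_assoc]
      by_cases h : threshold a b ε (lastStages a b ε (s + 1 + k)) ≤ b (s + 1 + k)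
      · rw [lastStages_succ_of_le h]
        have := ih.trans h
        rw [threshold]
        linarith
      · rwa [lastStages_succ_of_not_le h]
  have hbound : ∀ n, (ε : ℝ) * (a n - a (lastStages a b ε s).1) ≤ β - b s := by
    intro n
    obtain ⟨t, ht, hrea⟩ := exists_threshold_le_of_not_covered ha hb hε hβ (max (s + 1) n)
    obtain ⟨k, rfl⟩ := Nat.exists_eq_add_of_le (le_of_max_le_left ht)
    have h1 := hinc (k + 1)
    rw [← add_assoc, lastStages_succ_of_le hrea] at h1
    have h2 := threshold_lt_of_not_covered ha hb hε hβ (s + 1 + k + 1)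
    rw [lastStages_succ_of_le hrea] at h2
    have h3 : a n ≤ a (s + 1 + k) := ha.strictMono.monotone (le_of_max_le_right ht)
    have h4 : ε * a n ≤ ε * a (s + 1 + k) := mul_le_mul_of_nonneg_left h3 hε.le
    have h5 : b s + ε * (a n - a (lastStages a b ε s).1)
        ≤ threshold a b ε (s + 1 + k, (lastStages a b ε (s + 1 + k)).1) := by
      linarith
    have h6 : (b s + ε * (a n - a (lastStages a b ε s).1) : ℝ)
        ≤ threshold a b ε (s + 1 + k, (lastStages a b ε (s + 1 + k)).1) := by
      exact_mod_cast h5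
    linarith
  exact le_of_tendsto ((ha.tendsto.sub_const _).const_mul _) (Filter.Eventually.of_forall hbound)

/-- Search for an update stage s ≥ i; since b i ≤ b s, the estimate at s also serves i. -/
theorem exists_computable_of_not_covered :
    ∃ h : ℕ → ℕ, Computable h ∧ ∀ i, ε * (α - a (h i)) ≤ β - b i := by
  have hex := exists_threshold_le_of_not_covered ha hb hε hβ
  have hpred : ComputablePred fun p : ℕ × ℕ =>
      p.1 ≤ p.2 ∧ threshold a b ε (lastStages a b ε p.2) ≤ b p.2 :=
    computablePred_and (computablePred_nat_le Computable.fst Computable.snd)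
      (computablePred_threshold_le ha.computable hb.computable (ComputableRat.const ε)
        (computable_lastStages ha.computable hb.computable (ComputableRat.const ε) Computable.snd) Computable.snd)
  have hfind := Computable.find
    (P := fun i s => i ≤ s ∧ threshold a b ε (lastStages a b ε s) ≤ b s) hpred hex
  refine ⟨fun i => (lastStages a b ε (Nat.find (hex i))).1,
    Computable.fst.comp
      (computable_lastStages ha.computable hb.computable (ComputableRat.const ε) hfind), fun i => ?_⟩
  obtain ⟨h1, h2⟩ := Nat.find_spec (hex i)
  have h3 := mul_sub_le_of_not_covered ha hb hε hβ h2
  have h4 : (b i : ℝ) ≤ b (Nat.find (hex i)) := Rat.cast_le.2 (hb.strictMono.monotone h1)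
  linarith

end NotCovered

/-- The Martin-Löf test that is passed only if `β` is above `α` for Solovay reducibility. -/
def solovayTest (ha : ApproxBelow a α) (hb : ComputableRat b) (m : ℕ)
    (hm : 2 * (α - a 0) ≤ 2 ^ m) : MartinLofTest where
  left x := b x.2
  right x := rightEnd a b ((1 / 2) ^ (x.1 + m)) x.2
  left_computable := hb.comp Computable.snd
  right_computable := by
    have he : ComputableRat fun x : ℕ × ℕ => (1 / 2 : ℚ) ^ (x.1 + m) :=
      ComputableRat.half_pow (computable_nat_add Computable.fst (Computable.const m))
    exact (hb.comp Computable.snd).add (((ComputableRat.const 2).mul he).mul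
      ((ha.computable.comp (Computable.fst.comp (computable_lastStages ha.computable hb he
        (Computable.succ.comp Computable.snd)))).sub
      (ha.computable.comp (Computable.fst.comp (computable_lastStages ha.computable hb he
        Computable.snd)))))
  total_length_le n := by
    refine (tsum_volume_rightEnd_le (b := b) (ε := (1 / 2) ^ (n + m)) ha (by positivity)).trans ?_
    have h1 : (2⁻¹ : ℝ≥0∞) ^ n = ENNReal.ofReal ((1 / 2) ^ n) := by
      rw [ENNReal.ofReal_pow (by positivity), one_div, ENNReal.ofReal_inv_of_pos (by positivity)]
      simp
    rw [h1]
    refine ENNReal.ofReal_le_ofReal ?_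
    have h2 : ((1 / 2 : ℝ) ^ m) * 2 ^ m = 1 := by rw [← mul_pow]; norm_num
    calc 2 * (((1 / 2) ^ (n + m) : ℚ) : ℝ) * (α - a 0)
        = (1 / 2) ^ n * ((1 / 2) ^ m * (2 * (α - a 0))) := by push_cast; ring
      _ ≤ (1 / 2) ^ n * ((1 / 2) ^ m * 2 ^ m) := by gcongr
      _ = (1 / 2) ^ n := by rw [h2, mul_one]

theorem SolovayComplete.of_random (hβ : LowerSemicomputable β) (hr : MartinLofRandom β) :
    SolovayComplete β := by
  refine ⟨hβ, fun α ⟨a, ha⟩ => ?_⟩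
  obtain ⟨b, hb⟩ := hβ
  -- The shift m absorbs the constant 2(α - a 0) of the length bound.
  obtain ⟨m, hm⟩ := pow_unbounded_of_one_lt (2 * (α - a 0)) (one_lt_two (α := ℝ))
  have hT := hr (solovayTest ha hb.computable m hm.le)
  rw [Set.mem_iInter, not_forall] at hT
  obtain ⟨n, hn⟩ := hT
  rw [MartinLofTest.cover, Set.mem_iUnion, not_exists] at hn
  obtain ⟨h, hh, hle⟩ := exists_computable_of_not_covered ha hb
    (ε := (1 / 2) ^ (n + m)) (by positivity) hn
  have hc : 0 < 2 ^ (n + m) := by positivity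
  refine ⟨2 ^ (n + m), hc, a, _, ha, hb.natCast_mul hc, h, hh, fun i => ?_⟩
  have h2 : (2 : ℝ) ^ (n + m) * (1 / 2) ^ (n + m) = 1 := by rw [← mul_pow]; norm_num
  have h3 := mul_le_mul_of_nonneg_left (hle i) (pow_nonneg zero_le_two (n + m) : (0 : ℝ) ≤ _)
  push_cast at h3 ⊢
  rw [← mul_assoc, h2, one_mul, mul_sub] at h3
  exact h3

end RandomToComplete

/-! ### Complete implies random: diagonalization against all reductions. -/

section CompleteToRandom

open Nat.Partrec (Code)

/-- The code of a partial computable function that is attached to a requirement `e`; the other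
component of `e` is a bound for the factor in a Solovay reduction. -/
def requirementCode (e : ℕ) : Code :=
  Denumerable.ofNat Code e.unpair.2

/-- For `x = ((e, k), (i, u, v))`: the index `i` is the first one for which `b i` exceeds the left
endpoint of the `k`-th interval of level `2 * e` of `T`, moreover `b i` lies in this interval, and
the computation of the function with code `requirementCode e` at `i` ends after exactly `u + 1` steps
with output `v`. -/
def Fires (T : MartinLofTest) (b : ℕ → ℚ) (x : (ℕ × ℕ) × (ℕ × ℕ × ℕ)) : Prop :=
  (T.left (2 * x.1.1, x.1.2) < b x.2.1 ∧ b x.2.1 < T.right (2 * x.1.1, x.1.2)) ∧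
  (x.2.1 = 0 ∨ b x.2.1.pred ≤ T.left (2 * x.1.1, x.1.2)) ∧
  Code.evaln (x.2.2.1 + 1) (requirementCode x.1.1) x.2.1 = some x.2.2.2 ∧
  Code.evaln x.2.2.1 (requirementCode x.1.1) x.2.1 = none

variable {T : MartinLofTest} {b : ℕ → ℚ} {β : ℝ}

theorem computablePred_fires (T : MartinLofTest) (hb : ComputableRat b) :
    ComputablePred (Fires T b) := by
  have he : Computable fun x : (ℕ × ℕ) × (ℕ × ℕ × ℕ) => x.1.1 :=
    Computable.fst.comp Computable.fst
  have hk : Computable fun x : (ℕ × ℕ) × (ℕ × ℕ × ℕ) => x.1.2 :=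
    Computable.snd.comp Computable.fst
  have hi : Computable fun x : (ℕ × ℕ) × (ℕ × ℕ × ℕ) => x.2.1 :=
    Computable.fst.comp Computable.snd
  have hu : Computable fun x : (ℕ × ℕ) × (ℕ × ℕ × ℕ) => x.2.2.1 :=
    Computable.fst.comp (Computable.snd.comp Computable.snd)
  have hv : Computable fun x : (ℕ × ℕ) × (ℕ × ℕ × ℕ) => x.2.2.2 :=
    Computable.snd.comp (Computable.snd.comp Computable.snd)
  have hI : Computable fun x : (ℕ × ℕ) × (ℕ × ℕ × ℕ) => (2 * x.1.1, x.1.2) :=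
    (computable_nat_mul (Computable.const 2) he).pair hk
  have hcode : Computable fun x : (ℕ × ℕ) × (ℕ × ℕ × ℕ) => requirementCode x.1.1 :=
    (Computable.ofNat Code).comp (Computable.snd.comp (Computable.unpair.comp he))
  have heval : ∀ {s : (ℕ × ℕ) × (ℕ × ℕ × ℕ) → ℕ}, Computable s →
      Computable fun x => Code.evaln (s x) (requirementCode x.1.1) x.2.1 := fun {s} hs =>
    Computable.comp (f := fun y : (ℕ × Code) × ℕ => Code.evaln y.1.1 y.1.2 y.2)
      (g := fun x => ((s x, requirementCode x.1.1), x.2.1))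
      Code.primrec_evaln.to_comp ((hs.pair hcode).pair hi)
  have hinterval := computablePred_and
    ((T.left_computable.comp hI).computablePred_lt (hb.comp hi))
    ((hb.comp hi).computablePred_lt (T.right_computable.comp hI))
  have hfirst := computablePred_or (computablePred_eq hi (Computable.const 0))
    ((hb.comp (Computable.pred.comp hi)).computablePred_le (T.left_computable.comp hI))
  have hhalt := computablePred_eq (heval (computable_nat_add hu (Computable.const 1)))
    (Computable.option_some.comp hv)
  have hrun := computablePred_eq (heval hu) (Computable.const none)
  refine (computablePred_and hinterval (computablePred_and hfirst
    (computablePred_and hhalt hrun))).of_eq fun x => ?_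
  rw [Fires]

/-- Minimality determines the index, then the exact halting time, then the output, so each interval
is charged at most once. -/
theorem Fires.snd_eq (hb : Monotone b) {y : ℕ × ℕ} {z z' : ℕ × ℕ × ℕ} (h : Fires T b (y, z))
    (h' : Fires T b (y, z')) : z = z' := by
  obtain ⟨i, u, v⟩ := z
  obtain ⟨i', u', v'⟩ := z'
  obtain ⟨⟨hl, -⟩, hi, hv, hu⟩ := h
  obtain ⟨⟨hl', -⟩, hi', hv', hu'⟩ := h'
  dsimp only at *
  have index_le : ∀ {i j : ℕ}, T.left (2 * y.1, y.2) < b i →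
      (j = 0 ∨ b j.pred ≤ T.left (2 * y.1, y.2)) → j ≤ i := by
    intro i j hi hj
    by_contra! hlt
    rcases hj with rfl | hj
    · exact Nat.not_lt_zero _ hlt
    · exact absurd (hb (Nat.le_pred_of_lt hlt)) (not_le.2 (hj.trans_lt hi))
  obtain rfl : i = i' := le_antisymm (index_le hl' hi) (index_le hl hi')
  have steps_le : ∀ {s t w : ℕ}, Code.evaln (s + 1) (requirementCode y.1) i = some w →
      Code.evaln t (requirementCode y.1) i = none → t ≤ s := by
    intro s t w hs ht
    by_contra! hlt
    have := Code.evaln_mono (Nat.succ_le_of_lt hlt) (Option.mem_def.2 hs)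
    rw [Option.mem_def, ht] at this
    exact Option.noConfusion rfl (heq_of_eq this)
  obtain rfl : u = u' := le_antisymm (steps_le hv' hu) (steps_le hv hu')
  obtain rfl : v = v' := Option.some_injective _ (hv.symm.trans hv')
  rfl

open Classical in
/-- The amount added to the diagonal real at stage `t`. -/
noncomputable def jump (T : MartinLofTest) (b : ℕ → ℚ) (t : ℕ) : ℚ :=
  let x := Denumerable.ofNat ((ℕ × ℕ) × (ℕ × ℕ × ℕ)) t
  if Fires T b x then
    (x.1.1 : ℚ) * (T.right (2 * x.1.1, x.1.2) - T.left (2 * x.1.1, x.1.2))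
  else 0

theorem computableRat_jump (T : MartinLofTest) (hb : ComputableRat b) :
    ComputableRat (jump T b) := by
  classical
  have hx := Computable.ofNat ((ℕ × ℕ) × (ℕ × ℕ × ℕ))
  have he := Computable.fst.comp (Computable.fst.comp hx)
  have hI := (computable_nat_mul (Computable.const 2) he).pair
    (Computable.snd.comp (Computable.fst.comp hx))
  exact ComputableRat.ite (computablePred_comp (computablePred_fires T hb) hx)
    ((ComputableRat.natCast he).mul ((T.right_computable.comp hI).sub (T.left_computable.comp hI)))
    (ComputableRat.const 0)

theorem jump_nonneg (T : MartinLofTest) (b : ℕ → ℚ) (t : ℕ) : 0 ≤ jump T b t := by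
  rw [jump]
  split_ifs with h
  · exact mul_nonneg (Nat.cast_nonneg _) (sub_nonneg.2 (h.1.1.trans h.1.2).le)
  · exact le_rfl

theorem tsum_ofReal_jump_ne_top (T : MartinLofTest) (hb : Monotone b) :
    ∑' t, ENNReal.ofReal (jump T b t) ≠ ∞ := by
  classical
  let vol : ℕ × ℕ → ℝ≥0∞ := fun y => (y.1 : ℝ≥0∞) *
    MeasureTheory.volume (Set.Ioo (T.left (2 * y.1, y.2) : ℝ) (T.right (2 * y.1, y.2) : ℝ))
  have hjump : ∀ x, ENNReal.ofReal (jump T b (Encodable.encode x))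
      = Set.indicator {x | Fires T b x} (fun x => vol x.1) x := by
    intro x
    rw [jump, Denumerable.ofNat_encode]
    by_cases h : Fires T b x
    · rw [if_pos h, Set.indicator_of_mem (show x ∈ {x | Fires T b x} from h)]
      simp only [vol]
      rw [Real.volume_Ioo]
      push_cast
      rw [ENNReal.ofReal_mul (Nat.cast_nonneg _), ENNReal.ofReal_natCast]
    · rw [if_neg h, Set.indicator_of_notMem (show x ∉ {x | Fires T b x} from h)]
      simp
  have hinj : Function.Injective fun x : {x | Fires T b x} => x.1.1 := by
    rintro ⟨⟨y, z⟩, h⟩ ⟨⟨y', z'⟩, h'⟩ (rfl : y = y')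
    simp only [Subtype.mk.injEq, Prod.mk.injEq, true_and]
    exact Fires.snd_eq hb h h'
  have hrow : ∀ e, ∑' k, vol (e, k) ≤ (2⁻¹ : ℝ≥0∞) ^ e := by
    intro e
    -- The weight e is paid for by using level 2e rather than e: e·2^(-2e) ≤ 2^(-e).
    have he : (e : ℝ≥0∞) ≤ 2 ^ e := by exact_mod_cast e.lt_two_pow_self.le
    calc ∑' k, vol (e, k) ≤ 2 ^ e * (2⁻¹ : ℝ≥0∞) ^ (2 * e) := by
          simp only [vol]
          rw [ENNReal.tsum_mul_left]
          exact mul_le_mul' he (T.total_length_le _)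
      _ = (2⁻¹ : ℝ≥0∞) ^ e := by
          rw [two_mul, pow_add, ← mul_assoc, ← mul_pow,
            ENNReal.mul_inv_cancel two_ne_zero ENNReal.ofNat_ne_top, one_pow, one_mul]
  have hle : ∑' t, ENNReal.ofReal (jump T b t) ≤ 2 := by
    calc ∑' t, ENNReal.ofReal (jump T b t)
        = ∑' x, ENNReal.ofReal (jump T b (Encodable.encode x)) :=
          ((Denumerable.eqv ((ℕ × ℕ) × (ℕ × ℕ × ℕ))).tsum_eq
            fun t => ENNReal.ofReal (jump T b t)).symm
      _ = ∑' x : {x | Fires T b x}, vol x.1.1 := by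
          simp only [hjump]
          exact (tsum_subtype _ _).symm
      _ ≤ ∑' y, vol y := ENNReal.tsum_comp_le_tsum_of_injective hinj vol
      _ = ∑' e, ∑' k, vol (e, k) := ENNReal.tsum_prod'
      _ ≤ ∑' e, (2⁻¹ : ℝ≥0∞) ^ e := ENNReal.tsum_le_tsum hrow
      _ = 2 := by rw [ENNReal.tsum_geometric, ENNReal.one_sub_inv_two, inv_inv]
  exact ne_top_of_le_ne_top ENNReal.ofNat_ne_top hle

/-- The summable terms 2^(-t) make the partial sums strictly increasing even where w vanishes. -/
theorem exists_approxBelow_sum {w : ℕ → ℚ} (hw : ComputableRat w) (hpos : ∀ t, 0 ≤ w t)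
    (hsum : ∑' t, ENNReal.ofReal (w t) ≠ ∞) :
    ∃ α, ApproxBelow (fun n => ∑ t ∈ Finset.range n, (w t + (1 / 2) ^ t)) α := by
  have hs : Summable fun t => (w t : ℝ) := by
    have h := ENNReal.summable_toReal hsum
    refine h.congr fun t => ?_
    exact ENNReal.toReal_ofReal (by exact_mod_cast hpos t)
  refine ⟨∑' t, ((w t : ℝ) + (1 / 2) ^ t), ⟨(hw.add (ComputableRat.half_pow Computable.id)).sum_range,
    strictMono_nat_of_lt_succ fun n => ?_, ?_⟩⟩
  · rw [Finset.sum_range_succ]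
    have := hpos n
    have : (0 : ℚ) < (1 / 2) ^ n := by positivity
    linarith
  · simpa using (hs.add summable_geometric_two).hasSum.tendsto_sum_nat

/-- Moves a reduction to prescribed approximations: of two approximations of the same real, each
computably overtakes the other. -/
theorem exists_computable_of_solovayLeOne {a : ℕ → ℚ} {α : ℝ} {c : ℕ} (ha : ApproxBelow a α)
    (hb : ApproxBelow b β) (hc : 0 < c) (h : SolovayLeOne α (c * β)) :
    ∃ g : ℕ → ℕ, Computable g ∧ ∀ i, α - a (g i) ≤ c * (β - b i) := by
  obtain ⟨a', b', ha', hb', f, hf, hle⟩ := h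
  have overtake : ∀ {p q : ℕ → ℚ} {γ : ℝ}, ApproxBelow p γ → ApproxBelow q γ →
      ∃ g : ℕ → ℕ, Computable g ∧ ∀ i, p i < q (g i) := by
    intro p q γ hp hq
    have hex : ∀ i, ∃ n, p i < q n := fun i => by
      obtain ⟨n, hn⟩ := hq.exists_lt (hp.lt_limit i)
      exact ⟨n, by exact_mod_cast hn⟩
    exact ⟨_, Computable.find (P := fun i n => p i < q n)
      ((hp.computable.comp Computable.fst).computablePred_lt
        (hq.computable.comp Computable.snd)) hex, fun i => Nat.find_spec (hex i)⟩
  obtain ⟨u, hu, hbu⟩ := overtake (hb.natCast_mul hc) hb'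
  obtain ⟨v, hv, hav⟩ := overtake ha' ha
  refine ⟨fun i => v (f (u i)), hv.comp (hf.comp hu), fun i => ?_⟩
  have h1 : ((c : ℝ) * b i) < b' (u i) := by exact_mod_cast hbu i
  have h2 : (a' (f (u i)) : ℝ) < a (v (f (u i))) := Rat.cast_lt.2 (hav _)
  have h3 := hle (u i)
  linarith

/-- Ensures that a jump indexed by a code with output v occurs no earlier than stage v. -/
theorem le_encode (y : ℕ × ℕ) (i u v : ℕ) : v ≤ Encodable.encode (y, (i, u, v)) := by
  simp only [Encodable.encode_prod_val, Encodable.encode_nat]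
  exact (Nat.right_le_pair _ _).trans ((Nat.right_le_pair _ _).trans (Nat.right_le_pair _ _))

theorem exists_fires (hb : ApproxBelow b β) {h : ℕ → ℕ} {e k : ℕ}
    (hcode : ∀ i, h i ∈ (requirementCode e).eval i)
    (hβ : β ∈ Set.Ioo (T.left (2 * e, k) : ℝ) (T.right (2 * e, k) : ℝ)) :
    ∃ i u, Fires T b ((e, k), (i, u, h i)) := by
  classical
  have hex : ∃ i, T.left (2 * e, k) < b i := by
    obtain ⟨i, hi⟩ := hb.exists_lt hβ.1
    exact ⟨i, by exact_mod_cast hi⟩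
  let i := Nat.find hex
  have hsteps : ∃ u, h i ∈ Code.evaln u (requirementCode e) i := Code.evaln_complete.1 (hcode i)
  -- `evaln` with bound 0 never halts, so the least bound is a successor.
  obtain ⟨u, hu⟩ : ∃ u, Nat.find hsteps = u + 1 := by
    refine Nat.exists_eq_succ_of_ne_zero fun h0 => ?_
    have := Nat.find_spec hsteps
    rw [h0] at this
    simp [Code.evaln] at this
  refine ⟨i, u, ⟨Nat.find_spec hex, ?_⟩, ?_, ?_, ?_⟩
  · have := (hb.lt_limit i).trans hβ.2
    exact_mod_cast this
  · rcases Nat.eq_zero_or_pos i with h0 | h0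
    · exact Or.inl h0
    · exact Or.inr (not_lt.1 (Nat.find_min hex (Nat.pred_lt h0.ne')))
  · have := Nat.find_spec hsteps
    rwa [hu] at this
  · refine Option.eq_none_iff_forall_not_mem.2 fun w hw => ?_
    have hw' : w = h i := Part.mem_unique (Code.evaln_sound hw) (hcode i)
    exact Nat.find_min hsteps (m := u) (by omega) (hw' ▸ hw)

theorem SolovayComplete.random (hβ : SolovayComplete β) : MartinLofRandom β := by
  classical
  intro T hT
  obtain ⟨⟨b, hb⟩, hcomplete⟩ := hβ
  obtain ⟨α, hα⟩ := exists_approxBelow_sum (computableRat_jump T hb.computable)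
    (jump_nonneg T b) (tsum_ofReal_jump_ne_top T hb.strictMono.monotone)
  set A : ℕ → ℚ := fun n => ∑ t ∈ Finset.range n, (jump T b t + (1 / 2) ^ t) with hA
  obtain ⟨c, hc, hle⟩ := hcomplete α ⟨A, hα⟩
  obtain ⟨h, hh, hred⟩ := exists_computable_of_solovayLeOne hα hb hc hle
  obtain ⟨code, hcode⟩ := Code.exists_code.1 (Partrec.nat_iff.1 hh.partrec)
  -- Pairing gives c ≤ e, so the weight e dominates the factor c.
  set e := Nat.pair c (Encodable.encode code) with he
  have hreq : ∀ i, h i ∈ (requirementCode e).eval i := by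
    intro i
    rw [requirementCode, he, Nat.unpair_pair, Denumerable.ofNat_encode, hcode]
    simp
  obtain ⟨k, hk⟩ := Set.mem_iUnion.1 (Set.mem_iInter.1 hT (2 * e))
  obtain ⟨i, u, hfire⟩ := exists_fires hb hreq hk
  set t := Encodable.encode ((e, k), (i, u, h i)) with ht
  have hjump : jump T b t = e * (T.right (2 * e, k) - T.left (2 * e, k)) := by
    rw [jump, ht, Denumerable.ofNat_encode]
    exact if_pos hfire
  have h1 : A (h i) ≤ A t := hα.strictMono.monotone (le_encode _ _ _ _)
  have h2 : A (t + 1) = A t + (jump T b t + (1 / 2) ^ t) := Finset.sum_range_succ _ _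
  have h3 : (0 : ℚ) < (1 / 2) ^ t := by positivity
  have h4 : A (h i) + e * (T.right (2 * e, k) - T.left (2 * e, k)) ≤ A (t + 1) := by
    rw [h2, hjump]
    linarith
  have h5 : (A (h i) + e * (T.right (2 * e, k) - T.left (2 * e, k)) : ℝ) ≤ A (t + 1) := by
    exact_mod_cast h4
  have h6 := hα.lt_limit (t + 1)
  have h7 := hred i
  have hce : (c : ℝ) ≤ e := by exact_mod_cast Nat.left_le_pair c _
  have hi : (T.left (2 * e, k) : ℝ) < b i := Rat.cast_lt.2 hfire.1.1
  -- Both β and b i lie in the interval, so the jump after stage h i outweighs what the reduction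
  -- allows.
  have h8 : (c : ℝ) * (β - b i) ≤ e * (T.right (2 * e, k) - T.left (2 * e, k)) :=
    mul_le_mul hce (by linarith [hk.2]) (sub_nonneg.2 (hb.lt_limit i).le) (Nat.cast_nonneg e)
  linarith

end CompleteToRandom

end SemicomputableReals

theorem mainTheorem1 (β : ℝ) (hβ : SemicomputableReals.LowerSemicomputable β) :
    SemicomputableReals.SolovayComplete β ↔ SemicomputableReals.MartinLofRandom β :=
  ⟨SemicomputableReals.SolovayComplete.random, SemicomputableReals.SolovayComplete.of_random hβ⟩
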